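/- \textbf{Setting.} A \emph{category of operations} is a symmetric monoidal category $\mathcal C$ with unit $I$ such that: (i) every morphism set $\mathcal C(X,Y)$ is a module over the semiring $\mathbb R_{\ge 0}$; (ii) composition and the tensor product of morphisms are bilinear; (iii) a symmetric monoidal subcategory $\mathcal C_1\subseteq\mathcal C$ containing all objects and identity morphisms (the \emph{normalized} operations) is given; (iv) $\mathcal C(I,I)=\mathbb R_{\ge 0}$, i.e. every morphism $I\to I$ is $r\cdot\mathrm{id}_I$ for a unique $r\ge 0$, and $\mathcal C_1(I,I)=\{\mathrm{id}_I\}$; (v) for every object $X$, $\mathcal C_1(X,I)$ has exactly one element. Let $V$ be a finite set, let $G=(V,E)$ with $E\subseteq V\times V$ be a directed acyclic graph, and for every $v\in V$ let $O_v$ be a finite set of outcomes. Write $\mathrm{in}(v)$ and $\mathrm{out}(v)$ for the sets of edges with target $v$, respectively with source $v$, and fix a linear ordering of each of these sets; tensor products below are taken in these orders. A \emph{$\mathcal C$-correlation} on $G$ is a function $P:\prod_{v\in V} O_v\to\mathbb R_{\ge 0}$ for which there are objects $X_e$ of $\mathcal C$ $(e\in E)$ and families of morphisms $$f_v(o_v):\bigotimes_{e\in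 \mathrm{in}(v)}X_e\longrightarrow\bigotimes_{e\in\mathrm{out}(v)}X_e\qquad(v\in V,\ o_v\in O_v)$$ such that $\sum_{o_v\in O_v}f_v(o_v)$ is normalized for every $v$ and such that, for every $o=(o_v)_{v\in V}$, the value of the string diagram obtained from $G$ by labelling every edge $e$ by $X_e$ and every node $v$ by $f_v(o_v)$ is $P(o)\cdot \mathrm{id}_I$. Here the value is the composite $I\to I$ obtained by composing the node morphisms, each tensored with identities on the remaining wires, one after the other compatibly with the edge directions, with the symmetries of $\mathcal C$ inserted to reorder the wires. Write $u\rightsquigarrow_G w$ if there is a directed path with at least one edge from $u$ to $w$ in $G$; this is the (strict) partial order, or causal set, induced by $G$. \textbf{Theorem.} Let $\mathcal C$ be a category of operations, $V$ a finite set and $(O_v)_{v\in V}$ a family of finite sets. (1) If $G$ and $G'$ are directed acyclic graphs on $V$ such that $u\rightsquigarrow_G w\iff u\rightsquigarrow_{G'}w$ for all $u,w\in V$, then, for all choices of the linear orderings for $G$ and for $G'$, the set of $\mathcal C$-correlations on $G$ with outcome sets $(O_v)$ equals the set of $\mathcal C$-correlations on $G'$ with outcome sets $(O_v)$. (2) In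 particular, if $G$ is a directed acyclic graph on $V$ with edges $u\to v$ and $v\to w$, then the graph $G'$ obtained from $G$ by adding the edge $u\to w$ is again a directed acyclic graph and, for all choices of the linear orderings, has the same set of $\mathcal C$-correlations as $G$. -/

import Mathlib

open CategoryTheory MonoidalCategory
open scoped NNReal

/-! ### Categories of operations -/

/-- A category of operations: a symmetric monoidal category whose morphism sets are modules over
the semiring of nonnegative reals, with bilinear composition and tensor product, together with a
wide symmetric monoidal subcategory of normalized operations, such that the scalars `I ⟶ I` are
exactly the nonnegative reals and the unit object is terminal in the normalized subcategory. -/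
class OperationCategory (C : Type*) [Category C] [MonoidalCategory C] [SymmetricCategory C] where
  /-- Operations can be added, and there is a zero operation. -/
  homAddCommMonoid : ∀ X Y : C, AddCommMonoid (X ⟶ Y)
  /-- Operations can be multiplied by nonnegative scalars. -/
  homModule : ∀ X Y : C, Module ℝ≥0 (X ⟶ Y)
  add_comp : ∀ {X Y Z : C} (f f' : X ⟶ Y) (g : Y ⟶ Z), (f + f') ≫ g = f ≫ g + f' ≫ g
  comp_add : ∀ {X Y Z : C} (f : X ⟶ Y) (g g' : Y ⟶ Z), f ≫ (g + g') = f ≫ g + f ≫ g'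
  smul_comp : ∀ {X Y Z : C} (r : ℝ≥0) (f : X ⟶ Y) (g : Y ⟶ Z), (r • f) ≫ g = r • (f ≫ g)
  comp_smul : ∀ {X Y Z : C} (r : ℝ≥0) (f : X ⟶ Y) (g : Y ⟶ Z), f ≫ (r • g) = r • (f ≫ g)
  add_tensorHom : ∀ {X₁ Y₁ X₂ Y₂ : C} (f f' : X₁ ⟶ Y₁) (g : X₂ ⟶ Y₂),
    (f + f') ⊗ₘ g = (f ⊗ₘ g) + (f' ⊗ₘ g)
  tensorHom_add : ∀ {X₁ Y₁ X₂ Y₂ : C} (f : X₁ ⟶ Y₁) (g g' : X₂ ⟶ Y₂),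
    f ⊗ₘ (g + g') = (f ⊗ₘ g) + (f ⊗ₘ g')
  smul_tensorHom : ∀ {X₁ Y₁ X₂ Y₂ : C} (r : ℝ≥0) (f : X₁ ⟶ Y₁) (g : X₂ ⟶ Y₂),
    (r • f) ⊗ₘ g = r • (f ⊗ₘ g)
  tensorHom_smul : ∀ {X₁ Y₁ X₂ Y₂ : C} (r : ℝ≥0) (f : X₁ ⟶ Y₁) (g : X₂ ⟶ Y₂),
    f ⊗ₘ (r • g) = r • (f ⊗ₘ g)
  /-- The normalized operations. -/
  normalized : MorphismProperty C
  /-- They form a symmetric monoidal subcategory containing all objects and identities. -/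
  normalized_symmetricMonoidal : normalized.IsStableUnderBraiding
  /-- Every operation from nothing to nothing is a unique nonnegative multiple of the identity. -/
  scalar_bijective : Function.Bijective (fun r : ℝ≥0 => r • 𝟙 (𝟙_ C))
  /-- The only normalized operation from nothing to nothing is the identity. -/
  normalized_unit_iff : ∀ f : 𝟙_ C ⟶ 𝟙_ C, normalized f ↔ f = 𝟙 (𝟙_ C)
  /-- Every system can be discarded by exactly one normalized operation. -/
  existsUnique_discard : ∀ X : C, ∃! f : X ⟶ 𝟙_ C, normalized f

attribute [reducible, instance] OperationCategory.homAddCommMonoid OperationCategory.homModule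

/-! ### Directed acyclic graphs -/

namespace Digraph

variable {V : Type*}

/-- `G.Reaches u w`: there is a directed path (with at least one edge) from `u` to `w`. For an
acyclic graph this is the strict partial order (causal order) induced by the graph. -/
def Reaches (G : Digraph V) (u w : V) : Prop := Relation.TransGen G.Adj u w

/-- A directed graph is acyclic if no node is reachable from itself by a directed path. -/
def Acyclic (G : Digraph V) : Prop := ∀ v, ¬ G.Reaches v v

/-- The type of edges of a directed graph, as ordered pairs (source, target). -/
abbrev Edge (G : Digraph V) : Type _ := {e : V × V // G.Adj e.1 e.2}

/-- The source node of an edge. -/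
def Edge.source {G : Digraph V} (e : G.Edge) : V := e.1.1

/-- The target node of an edge. -/
def Edge.target {G : Digraph V} (e : G.Edge) : V := e.1.2

/-- The graph `G` with the edge `u → w` added. -/
def addEdge (G : Digraph V) (u w : V) : Digraph V where
  Adj a b := G.Adj a b ∨ (a = u ∧ b = w)

/-- A polarization of a graph: a linear ordering of the incoming edges and of the outgoing edges
of every node, given as lists without repetitions. -/
structure Polarization (G : Digraph V) where
  /-- the ordered list of incoming edges of a node -/
  ins : V → List G.Edge
  /-- the ordered list of outgoing edges of a node -/
  outs : V → List G.Edge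
  nodup_ins : ∀ v, (ins v).Nodup
  nodup_outs : ∀ v, (outs v).Nodup
  mem_ins : ∀ v e, e ∈ ins v ↔ e.target = v
  mem_outs : ∀ v e, e ∈ outs v ↔ e.source = v

/-- Every finite graph can be polarized. -/
theorem Polarization.nonempty [Finite V] (G : Digraph V) : Nonempty G.Polarization := by
  classical
  have : Finite G.Edge := Subtype.finite
  have := Fintype.ofFinite G.Edge
  exact ⟨{
    ins := fun v => (Finset.univ.filter fun e : G.Edge => e.target = v).toList
    outs := fun v => (Finset.univ.filter fun e : G.Edge => e.source = v).toList
    nodup_ins := fun v => Finset.nodup_toList _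
    nodup_outs := fun v => Finset.nodup_toList _
    mem_ins := fun v e => by simp
    mem_outs := fun v e => by simp }⟩

end Digraph

/-! ### Values of labelled graphs -/

section Wires

variable {C : Type*} [Category C] [MonoidalCategory C] {E : Type*}

/-- The tensor product of the objects `X e` along a list of wires `e`. -/
def wireTensor (X : E → C) : List E → C
  | [] => 𝟙_ C
  | e :: l => X e ⊗ wireTensor X l

/-- The canonical isomorphism turning concatenation of lists into a binary tensor product, built
from associators and unitors. -/
def wireAppend (X : E → C) :
    (l₁ l₂ : List E) → (wireTensor X (l₁ ++ l₂) ≅ wireTensor X l₁ ⊗ wireTensor X l₂)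
  | [], l₂ => (λ_ (wireTensor X l₂)).symm
  | e :: l₁, l₂ =>
      whiskerLeftIso (X e) (wireAppend X l₁ l₂) ≪≫
        (α_ (X e) (wireTensor X l₁) (wireTensor X l₂)).symm

/-- A way of crossing wires so as to reorder one list of wires into another. -/
inductive Crossing {E : Type*} : List E → List E → Type _
  | nil : Crossing [] []
  | cons (a : E) {l l' : List E} : Crossing l l' → Crossing (a :: l) (a :: l')
  | swap (a b : E) (l : List E) : Crossing (a :: b :: l) (b :: a :: l)
  | trans {l l' l'' : List E} : Crossing l l' → Crossing l' l'' → Crossing l l''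

/-- The composite of symmetries of the category that is drawn by a crossing of wires. If the list
of wires has no repetitions, this morphism depends only on the two lists, by the coherence theorem
for symmetric monoidal categories. -/
def Crossing.hom [SymmetricCategory C] (X : E → C) :
    {l l' : List E} → Crossing l l' → (wireTensor X l ⟶ wireTensor X l')
  | _, _, .nil => 𝟙 (𝟙_ C)
  | _, _, .cons a r => X a ◁ r.hom X
  | _, _, .swap a b l =>
      (α_ (X a) (X b) (wireTensor X l)).inv ≫
        ((β_ (X a) (X b)).hom ▷ wireTensor X l) ≫ (α_ (X b) (X a) (wireTensor X l)).hom
  | _, _, .trans r s => r.hom X ≫ s.hom X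

end Wires

section Value

variable {C : Type*} [Category C] [MonoidalCategory C] [SymmetricCategory C]
  {V : Type*} {G : Digraph V}

/-- `Evaluates p X g vs l m`: the initial part of the labelled graph consisting of the nodes in
`vs`, with the wires in `l` leaving it at the top, evaluates to `m : I ⟶ ⨂_{e ∈ l} X e`. One starts
with the empty diagram. A further node `v` can be put on top as soon as all its incoming edges are
among the open wires: these are brought to the front, in their order at `v`, the morphism `g v` is
applied to them in parallel with the identity on the remaining wires, and the outgoing edges of `v`
become open wires. -/
inductive Evaluates (p : G.Polarization) (X : G.Edge → C)
    (g : ∀ v, wireTensor X (p.ins v) ⟶ wireTensor X (p.outs v)) :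
    (vs : List V) → (l : List G.Edge) → (𝟙_ C ⟶ wireTensor X l) → Prop
  | empty : Evaluates p X g [] [] (𝟙 (𝟙_ C))
  | node (v : V) {vs : List V} {l : List G.Edge} {m : 𝟙_ C ⟶ wireTensor X l}
      (rest : List G.Edge) (r : Crossing l (p.ins v ++ rest)) :
      v ∉ vs → Evaluates p X g vs l m →
      Evaluates p X g (v :: vs) (p.outs v ++ rest)
        (m ≫ r.hom X ≫ (wireAppend X (p.ins v) rest).hom ≫ (g v ▷ wireTensor X rest) ≫
          (wireAppend X (p.outs v) rest).inv)

/-- `φ` is the value of the graph (without boundary) whose edges `e` are labelled by the objects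
`X e` and whose nodes `v` are labelled by the morphisms `g v`: composing the diagram node by node,
with every node used exactly once and no wire left open, yields `φ`. -/
def IsValue (p : G.Polarization) (X : G.Edge → C)
    (g : ∀ v, wireTensor X (p.ins v) ⟶ wireTensor X (p.outs v)) (φ : 𝟙_ C ⟶ 𝟙_ C) : Prop :=
  ∃ vs : List V, (∀ v, v ∈ vs) ∧ Evaluates p X g vs [] φ

end Value

/-! ### Correlations -/

/-- A `C`-instrument with finite outcome set `O`: a family of operations, indexed by the outcomes,
whose sum is normalized. -/
def IsInstrument {C : Type*} [Category C] [MonoidalCategory C] [SymmetricCategory C]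
    [OperationCategory C] {O : Type*} [Fintype O] {X Y : C} (f : O → (X ⟶ Y)) : Prop :=
  OperationCategory.normalized (∑ o, f o)

/-- The set of `C`-correlations on the polarized graph `(G, p)` with outcome sets `O v`: all
`P (o[V])` arising from a labelling of the edges by objects of `C` and of the nodes by
`C`-instruments, `P o` being the nonnegative number corresponding to the value of the graph in
which each node `v` carries the operation for the outcome `o v`. -/
def correlations (C : Type*) [Category C] [MonoidalCategory C] [SymmetricCategory C]
    [OperationCategory C] {V : Type*} (G : Digraph V) (p : G.Polarization)
    (O : V → Type*) [∀ v, Fintype (O v)] : Set ((∀ v, O v) → ℝ≥0) :=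
  {P | ∃ (X : G.Edge → C)
      (f : ∀ v, O v → (wireTensor X (p.ins v) ⟶ wireTensor X (p.outs v))),
      (∀ v, IsInstrument (f v)) ∧
      ∀ o : ∀ v, O v, IsValue p X (fun v => f v (o v)) (P o • 𝟙 (𝟙_ C))}

/-! By symmetry it suffices to turn a correlation on `G` into one on `G'` (`correlations_subset`).
Every edge of `G` joins two nodes connected by a path in `G'`, and can be routed along that path. An
edge of `G'` is then labelled by the tensor product of all labels routed through it, and a node
applies its old operation to its own wires while forwarding the passing wires unchanged.
Rearrangements of wires are normalized, so the new families are again instruments.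

The value does not change because an evaluation of `G` can be followed in `G'` in the same order of
nodes (`Evaluates.simulate`): reachability in `G'` implies reachability in `G`, so whenever a node
can be placed in `G`, its incoming wires in `G'` are open too.

Comparing the two evaluations requires coherence (`Crossing.hom_eq`): a rearrangement of distinct
wires depends only on its source and target. Each crossing is brought to a normal form that extracts
the wires one at a time in the target order, and for distinct wires this normal form is unique.
`Structural` carries coherence over to objects that are merely identified with tensor products of
wires, such as bundles.

A shortcut edge creates no new reachability, so the second claim is a case of the first. -/

/-! ### Coherence for symmetries, by normal forms of crossings -/

section Coherence

variable {C : Type*} [Category C] [MonoidalCategory C] {E : Type*}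

/-- Exchange of the first two factors of a threefold tensor product. -/
def wireSwap [SymmetricCategory C] (A B Z : C) : A ⊗ B ⊗ Z ⟶ B ⊗ A ⊗ Z :=
  (α_ A B Z).inv ≫ ((β_ A B).hom ▷ Z) ≫ (α_ B A Z).hom

/-- A way of removing one occurrence of `a` from a list. -/
inductive Pull (a : E) : List E → List E → Type _
  | head (l : List E) : Pull a (a :: l) l
  | tail (b : E) {l r : List E} : Pull a l r → Pull a (b :: l) (b :: r)

/-- A way of enumerating the elements of the first list in the order of the second list. -/
inductive Enumeration : List E → List E → Type _
  | nil : Enumeration [] []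
  | cons {a : E} {l r t : List E} : Pull a l r → Enumeration r t → Enumeration l (a :: t)

variable [SymmetricCategory C]

theorem wireSwap_wireSwap (A B Z : C) : wireSwap A B Z ≫ wireSwap B A Z = 𝟙 _ := by
  simp [wireSwap, ← comp_whiskerRight_assoc]

theorem wireSwap_naturality (A B : C) {Z Z' : C} (f : Z ⟶ Z') :
    A ◁ B ◁ f ≫ wireSwap A B Z' = wireSwap A B Z ≫ B ◁ A ◁ f := by
  simp only [wireSwap, Category.assoc]
  rw [associator_inv_naturality_right_assoc, whisker_exchange_assoc,
    associator_naturality_right]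

theorem wireSwap_yang_baxter (A B D Z : C) :
    A ◁ wireSwap B D Z ≫ wireSwap A D (B ⊗ Z) ≫ D ◁ wireSwap A B Z =
      wireSwap A B (D ⊗ Z) ≫ B ◁ wireSwap A D Z ≫ wireSwap B D (A ⊗ Z) := by
  have h := BraidedCategory.yang_baxter A B D
  calc _ = 𝟙 _ ⊗≫ ((α_ A B D).hom ≫ A ◁ (β_ B D).hom ≫ (α_ A D B).inv ≫
        (β_ A D).hom ▷ B ≫ (α_ D A B).hom ≫ D ◁ (β_ A B).hom) ▷ Z ⊗≫ 𝟙 _ := by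
        dsimp only [wireSwap]; monoidal
    _ = 𝟙 _ ⊗≫ ((β_ A B).hom ▷ D ≫ (α_ B A D).hom ≫ B ◁ (β_ A D).hom ≫
        (α_ B D A).inv ≫ (β_ B D).hom ▷ A ≫ (α_ D B A).hom) ▷ Z ⊗≫ 𝟙 _ := by
        congr 3
        simpa using congrArg (fun k => (α_ A B D).hom ≫ k) h.symm
    _ = _ := by dsimp only [wireSwap]; monoidal

/-- Moving the chosen wire to the front. -/
def Pull.hom (X : E → C) {a : E} : {l r : List E} → Pull a l r →
    (wireTensor X l ⟶ X a ⊗ wireTensor X r)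
  | _, _, .head l => 𝟙 (X a ⊗ wireTensor X l)
  | _, _, .tail (r := r) b p => X b ◁ p.hom X ≫ wireSwap (X b) (X a) (wireTensor X r)

/-- The morphism that brings the wires into their new order one by one. -/
def Enumeration.hom (X : E → C) : {l l' : List E} → Enumeration l l' →
    (wireTensor X l ⟶ wireTensor X l')
  | _, _, .nil => 𝟙 (𝟙_ C)
  | _, _, .cons (a := a) p c => p.hom X ≫ X a ◁ c.hom X

/-- Two wires can be extracted in either order, at the cost of one symmetry between them. When both
lie behind a third wire, the induction step is the Yang–Baxter equation. -/
theorem Pull.exists_comm (X : E → C) {a : E} {l r : List E} (P : Pull a l r) :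
    ∀ {b : E} {s : List E} (Q : Pull b r s), ∃ (r' : List E) (Q' : Pull b l r') (P' : Pull a r' s),
      P.hom X ≫ X a ◁ Q.hom X =
        Q'.hom X ≫ X b ◁ P'.hom X ≫ wireSwap (X b) (X a) (wireTensor X s) := by
  induction P with
  | head l =>
    intro b s Q
    refine ⟨a :: s, .tail a Q, .head s, ?_⟩
    simp [Pull.hom, wireTensor, wireSwap_wireSwap]
  | tail c P ih =>
    intro b s Q
    cases Q with
    | head =>
      refine ⟨_, .head _, P, ?_⟩
      simp [Pull.hom, wireTensor]
    | tail _ Q =>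
      rename_i l0 r0 s0
      obtain ⟨r', Q', P', h⟩ := ih Q
      refine ⟨c :: r', .tail c Q', .tail c P', ?_⟩
      simp only [Pull.hom, Category.assoc, MonoidalCategory.whiskerLeft_comp, wireTensor]
      rw [← reassoc_of% @wireSwap_naturality, ← MonoidalCategory.whiskerLeft_comp_assoc, h,
        ← reassoc_of% @wireSwap_naturality, MonoidalCategory.whiskerLeft_comp_assoc,
        MonoidalCategory.whiskerLeft_comp_assoc, wireSwap_yang_baxter]

/-- A wire extracted after a reordering could have been extracted before it. This is the step that
makes normal forms composable; the symmetry produced by `Pull.exists_comm` cancels against the one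
in `Pull.hom`. -/
theorem Enumeration.exists_pull (X : E → C) {l l' : List E} (c : Enumeration l l') :
    ∀ {a : E} {r' : List E} (P : Pull a l' r'), ∃ (r : List E) (Q : Pull a l r)
      (d : Enumeration r r'), c.hom X ≫ P.hom X = Q.hom X ≫ X a ◁ d.hom X := by
  induction c with
  | nil => intro a r' P; cases P
  | cons Q c ih =>
    intro a r' P
    cases P with
    | head => exact ⟨_, Q, c, by simp [Pull.hom, Enumeration.hom, wireTensor]⟩
    | tail _ P =>
      obtain ⟨s', P', d, h⟩ := ih P
      obtain ⟨r, P'', Q', h'⟩ := Q.exists_comm X P'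
      refine ⟨r, P'', .cons Q' d, ?_⟩
      simp only [Pull.hom, Enumeration.hom, Category.assoc, MonoidalCategory.whiskerLeft_comp,
        wireTensor]
      rw [← MonoidalCategory.whiskerLeft_comp_assoc, h, MonoidalCategory.whiskerLeft_comp_assoc,
        reassoc_of% h', wireSwap_naturality, reassoc_of% @wireSwap_wireSwap]

theorem Enumeration.exists_comp (X : E → C) {l' l'' : List E} (d : Enumeration l' l'') :
    ∀ {l : List E} (c : Enumeration l l'),
      ∃ k : Enumeration l l'', k.hom X = c.hom X ≫ d.hom X := by
  induction d with
  | nil => exact fun c => ⟨c, (Category.comp_id _).symm⟩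
  | cons P d ih =>
    intro l c
    obtain ⟨r, Q, e, h⟩ := c.exists_pull X P
    obtain ⟨k, hk⟩ := ih e
    exact ⟨.cons Q k, by
      simp only [Enumeration.hom, hk, MonoidalCategory.whiskerLeft_comp, wireTensor]
      exact ((reassoc_of% h) _).symm⟩

theorem Enumeration.exists_id (X : E → C) (l : List E) :
    ∃ c : Enumeration l l, c.hom X = 𝟙 _ := by
  induction l with
  | nil => exact ⟨.nil, rfl⟩
  | cons a l ih =>
    obtain ⟨c, hc⟩ := ih
    exact ⟨.cons (.head l) c, by simp [Enumeration.hom, Pull.hom, hc, wireTensor]⟩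

/-- Existence of normal forms: the generating crossings have one, and `Enumeration.exists_comp`
handles composites. -/
theorem Crossing.exists_enumeration (X : E → C) {l l' : List E} (r : Crossing l l') :
    ∃ c : Enumeration l l', c.hom X = r.hom X := by
  induction r with
  | nil => exact ⟨.nil, rfl⟩
  | cons a r ih =>
    obtain ⟨c, hc⟩ := ih
    exact ⟨.cons (.head _) c, by
      simp only [Enumeration.hom, Crossing.hom, Pull.hom, hc]
      exact Category.id_comp _⟩
  | swap a b l =>
    obtain ⟨c, hc⟩ := Enumeration.exists_id X (a :: l)
    refine ⟨.cons (.tail a (.head l)) c, ?_⟩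
    simp [Enumeration.hom, Crossing.hom, Pull.hom, hc, wireSwap, wireTensor]
  | trans r s ihr ihs =>
    obtain ⟨c, hc⟩ := ihr
    obtain ⟨d, hd⟩ := ihs
    obtain ⟨k, hk⟩ := d.exists_comp X c
    exact ⟨k, by rw [hk, hc, hd]; rfl⟩

theorem Pull.perm {a : E} {l r : List E} (P : Pull a l r) : l.Perm (a :: r) := by
  induction P with
  | head l => exact List.Perm.refl _
  | tail b P ih => exact (ih.cons b).trans (List.Perm.swap _ _ _)

/-- In a list without repetitions the wire `a` has only one position, so there is only one way to
extract it. -/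
theorem Pull.unique {a : E} {l r : List E} (P : Pull a l r) (hl : l.Nodup) :
    ∀ {r' : List E} (P' : Pull a l r'), ∃ h : r = r', h ▸ P = P' := by
  induction P with
  | head l =>
    intro r' P'
    cases P' with
    | head => exact ⟨rfl, rfl⟩
    | tail _ P' => exact absurd (P'.perm.mem_iff.2 (by simp)) (List.nodup_cons.1 hl).1
  | tail b P ih =>
    intro r' P'
    cases P' with
    | head => exact absurd (P.perm.mem_iff.2 (by simp)) (List.nodup_cons.1 hl).1
    | tail _ P' =>
      obtain ⟨rfl, rfl⟩ := ih (List.nodup_cons.1 hl).2 P'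
      exact ⟨rfl, rfl⟩

theorem Enumeration.unique {l l' : List E} (c : Enumeration l l') (hl : l.Nodup) :
    ∀ c' : Enumeration l l', c = c' := by
  induction c with
  | nil => intro c'; cases c'; rfl
  | cons P c ih =>
    intro c'
    cases c' with
    | cons P' c' =>
      obtain ⟨rfl, rfl⟩ := P.unique hl P'
      rw [ih (List.nodup_cons.1 (P.perm.nodup_iff.1 hl)).2 c']

/-- Coherence: a crossing of distinct wires is determined by its source and target. -/
theorem Crossing.hom_eq (X : E → C) {l l' : List E} (hl : l.Nodup) (r s : Crossing l l') :
    r.hom X = s.hom X := by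
  obtain ⟨c, hc⟩ := r.exists_enumeration X
  obtain ⟨d, hd⟩ := s.exists_enumeration X
  rw [← hc, ← hd, c.unique hl d]

end Coherence
-- Block crossings and structural morphisms
section Structural

variable {C : Type*} [Category C] [MonoidalCategory C] {E : Type*}

/-- The inverse crossing. -/
def Crossing.symm : {l l' : List E} → Crossing l l' → Crossing l' l
  | _, _, .nil => .nil
  | _, _, .cons a r => .cons a r.symm
  | _, _, .swap a b l => .swap b a l
  | _, _, .trans r s => .trans s.symm r.symm

/-- The trivial crossing. -/
def Crossing.refl : (l : List E) → Crossing l l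
  | [] => .nil
  | a :: l => .cons a (Crossing.refl l)

/-- A crossing to the right of further wires. -/
def Crossing.left : (A : List E) → {l l' : List E} → Crossing l l' → Crossing (A ++ l) (A ++ l')
  | [], _, _, r => r
  | a :: A, _, _, r => .cons a (r.left A)

/-- A crossing to the left of further wires. -/
def Crossing.right (B : List E) : {l l' : List E} → Crossing l l' → Crossing (l ++ B) (l' ++ B)
  | _, _, .nil => Crossing.refl B
  | _, _, .cons a r => .cons a (r.right B)
  | _, _, .swap a b l => .swap a b (l ++ B)
  | _, _, .trans r s => .trans (r.right B) (s.right B)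

/-- The trivial crossing between the two ways of concatenating three lists. -/
def Crossing.assoc : (A B D : List E) → Crossing (A ++ B ++ D) (A ++ (B ++ D))
  | [], B, D => Crossing.refl (B ++ D)
  | a :: A, B, D => .cons a (Crossing.assoc A B D)

/-- The trivial crossing that appends no wires. -/
def Crossing.appendNil : (B : List E) → Crossing B (B ++ [])
  | [] => .nil
  | b :: B => .cons b (Crossing.appendNil B)

/-- Moving a wire across a block of wires. -/
def Crossing.move (a : E) : (B R : List E) → Crossing (a :: (B ++ R)) (B ++ (a :: R))
  | [], R => Crossing.refl (a :: R)
  | b :: B, R => .trans (.swap a b (B ++ R)) (.cons b (Crossing.move a B R))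

/-- Exchanging two blocks of wires. -/
def Crossing.block : (A B : List E) → Crossing (A ++ B) (B ++ A)
  | [], B => Crossing.appendNil B
  | a :: A, B => .trans (.cons a (Crossing.block A B)) (Crossing.move a B A)

theorem Crossing.nonempty_of_perm {l l' : List E} (h : l.Perm l') : Nonempty (Crossing l l') := by
  induction h with
  | nil => exact ⟨.nil⟩
  | cons a _ ih => exact ih.map (.cons a)
  | swap a b l => exact ⟨.swap b a l⟩
  | trans _ _ ih ih' => exact ⟨.trans ih.some ih'.some⟩

theorem Crossing.perm {l l' : List E} (r : Crossing l l') : l.Perm l' := by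
  induction r with
  | nil => exact .refl _
  | cons a _ ih => exact ih.cons a
  | swap a b l => exact .swap b a l
  | trans _ _ ih ih' => exact ih.trans ih'

/-- If objects are interpreted as tensor products of lists of wires, then so is their tensor
product. -/
def wireTensorIso (X : E → C) {Z Z' : C} {l l' : List E} (φ : Z ≅ wireTensor X l)
    (ψ : Z' ≅ wireTensor X l') : Z ⊗ Z' ≅ wireTensor X (l ++ l') :=
  (φ ⊗ᵢ ψ) ≪≫ (wireAppend X l l').symm

/-- If every wire of one kind is interpreted as a bundle of wires of another kind, then so are
tensor products of wires of the first kind. -/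
def bundleIso (X : E → C) {F : Type*} {Y : F → C} {L : F → List E}
    (θ : ∀ e, Y e ≅ wireTensor X (L e)) :
    (k : List F) → (wireTensor Y k ≅ wireTensor X (k.flatMap L))
  | [] => Iso.refl (𝟙_ C)
  | e :: k => wireTensorIso X (θ e) (bundleIso X θ k)

variable [SymmetricCategory C] (X : E → C)

theorem Crossing.hom_symm {l l' : List E} (r : Crossing l l') :
    r.hom X ≫ r.symm.hom X = 𝟙 _ := by
  induction r with
  | nil => exact Category.comp_id _
  | cons a r ih =>
    simp only [Crossing.symm, Crossing.hom, wireTensor]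
    rw [← MonoidalCategory.whiskerLeft_comp, ih, MonoidalCategory.whiskerLeft_id]
  | swap a b l => exact wireSwap_wireSwap _ _ _
  | trans r s ihr ihs =>
    simp only [Crossing.symm, Crossing.hom, Category.assoc]
    rw [reassoc_of% ihs, ihr]

theorem Crossing.symm_symm {l l' : List E} (r : Crossing l l') : r.symm.symm = r := by
  induction r with
  | nil => rfl
  | cons a r ih => simp [Crossing.symm, ih]
  | swap a b l => rfl
  | trans r s ihr ihs => simp [Crossing.symm, ihr, ihs]

theorem Crossing.symm_hom {l l' : List E} (r : Crossing l l') :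
    r.symm.hom X ≫ r.hom X = 𝟙 _ := by
  simpa [r.symm_symm] using r.symm.hom_symm X

theorem Crossing.refl_hom (l : List E) : (Crossing.refl l).hom X = 𝟙 _ := by
  induction l with
  | nil => rfl
  | cons a l ih => simp [Crossing.refl, Crossing.hom, ih, wireTensor]

theorem Crossing.left_hom (A : List E) {l l' : List E} (r : Crossing l l') :
    (r.left A).hom X ≫ (wireAppend X A l').hom =
      (wireAppend X A l).hom ≫ wireTensor X A ◁ r.hom X := by
  induction A with
  | nil => simp [Crossing.left, wireAppend, wireTensor]
  | cons a A ih =>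
    -- The induction step is stated for arbitrary objects, so that the tensor factors are visible to
    -- rewriting and to `monoidal`; it is then matched with `wireTensor` of appended lists by
    -- definitional unfolding. The later `key` statements play the same role.
    have key : ∀ {P P' T L L' : C} (f : P ⟶ P') (p : P ⟶ T ⊗ L) (p' : P' ⟶ T ⊗ L') (r : L ⟶ L'),
        f ≫ p' = p ≫ T ◁ r → X a ◁ f ≫ X a ◁ p' ≫ (α_ (X a) T L').inv =
          (X a ◁ p ≫ (α_ (X a) T L).inv) ≫ (X a ⊗ T) ◁ r := by
      intro P P' T L L' f p p' r h
      rw [← MonoidalCategory.whiskerLeft_comp_assoc, h]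
      monoidal
    exact key _ _ _ _ ih

theorem Crossing.right_hom (B : List E) {l l' : List E} (r : Crossing l l') :
    (r.right B).hom X ≫ (wireAppend X l' B).hom =
      (wireAppend X l B).hom ≫ r.hom X ▷ wireTensor X B := by
  induction r with
  | nil => simp [Crossing.right, Crossing.refl_hom, Crossing.hom, wireTensor]
  | cons a r ih =>
    have key : ∀ {P P' L L' T : C} (f : P ⟶ P') (p : P ⟶ L ⊗ T) (p' : P' ⟶ L' ⊗ T) (r : L ⟶ L'),
        f ≫ p' = p ≫ r ▷ T → X a ◁ f ≫ X a ◁ p' ≫ (α_ (X a) L' T).inv =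
          (X a ◁ p ≫ (α_ (X a) L T).inv) ≫ (X a ◁ r) ▷ T := by
      intro P P' L L' T f p p' r h
      rw [← MonoidalCategory.whiskerLeft_comp_assoc, h]
      monoidal
    exact key _ _ _ _ ih
  | swap a b l =>
    have key : ∀ {P L T : C} (p : P ⟶ L ⊗ T),
        wireSwap (X a) (X b) P ≫ X b ◁ (X a ◁ p ≫ (α_ (X a) L T).inv) ≫
            (α_ (X b) (X a ⊗ L) T).inv =
          (X a ◁ (X b ◁ p ≫ (α_ (X b) L T).inv) ≫ (α_ (X a) (X b ⊗ L) T).inv) ≫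
            wireSwap (X a) (X b) L ▷ T := by
      intro P L T p
      rw [MonoidalCategory.whiskerLeft_comp_assoc, ← reassoc_of% @wireSwap_naturality]
      dsimp only [wireSwap]
      monoidal
    exact key _
  | trans r s ihr ihs =>
    simp only [Crossing.right, Crossing.hom, Category.assoc]
    rw [ihs, reassoc_of% ihr, comp_whiskerRight]

theorem Crossing.assoc_hom (A B D : List E) :
    (Crossing.assoc A B D).hom X ≫ (wireAppend X A (B ++ D)).hom ≫
        wireTensor X A ◁ (wireAppend X B D).hom =
      (wireAppend X (A ++ B) D).hom ≫ (wireAppend X A B).hom ▷ wireTensor X D ≫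
        (α_ (wireTensor X A) (wireTensor X B) (wireTensor X D)).hom := by
  induction A with
  | nil => simp [Crossing.assoc, Crossing.refl_hom, wireAppend, wireTensor]
  | cons a A ih =>
    have key : ∀ {P Q S U A B D : C} (f : P ⟶ Q) (p : Q ⟶ A ⊗ S) (q : S ⟶ B ⊗ D)
        (u : P ⟶ U ⊗ D) (w : U ⟶ A ⊗ B), f ≫ p ≫ A ◁ q = u ≫ w ▷ D ≫ (α_ A B D).hom →
        X a ◁ f ≫ (X a ◁ p ≫ (α_ (X a) A S).inv) ≫ (X a ⊗ A) ◁ q =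
          (X a ◁ u ≫ (α_ (X a) U D).inv) ≫ (X a ◁ w ≫ (α_ (X a) A B).inv) ▷ D ≫
            (α_ (X a ⊗ A) B D).hom := by
      intro P Q S U A B D f p q u w h
      calc _ = X a ◁ (f ≫ p ≫ A ◁ q) ≫ (α_ (X a) A (B ⊗ D)).inv := by monoidal
        _ = _ := by rw [h]; monoidal
    exact key _ _ _ _ _ ih

theorem Crossing.appendNil_hom (B : List E) :
    (Crossing.appendNil B).hom X ≫ (wireAppend X B []).hom = (ρ_ (wireTensor X B)).inv := by
  induction B with
  | nil =>
    simp [Crossing.appendNil, Crossing.hom, wireAppend, wireTensor, unitors_inv_equal]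
  | cons b B ih =>
    have key : ∀ {P B : C} (f : B ⟶ P) (p : P ⟶ B ⊗ 𝟙_ C), f ≫ p = (ρ_ B).inv →
        X b ◁ f ≫ X b ◁ p ≫ (α_ (X b) B (𝟙_ C)).inv = (ρ_ (X b ⊗ B)).inv := by
      intro P B f p h
      rw [← MonoidalCategory.whiskerLeft_comp_assoc, h]
      monoidal
    exact key _ _ ih

theorem wireSwap_tensor (A B D Z : C) :
    wireSwap A B (D ⊗ Z) ≫ B ◁ wireSwap A D Z ≫ (α_ B D (A ⊗ Z)).inv =
      A ◁ (α_ B D Z).inv ≫ wireSwap A (B ⊗ D) Z := by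
  simp only [wireSwap, BraidedCategory.braiding_tensor_right_hom]
  monoidal

theorem Crossing.move_hom (a : E) (B R : List E) :
    (Crossing.move a B R).hom X ≫ (wireAppend X B (a :: R)).hom =
      X a ◁ (wireAppend X B R).hom ≫ wireSwap (X a) (wireTensor X B) (wireTensor X R) := by
  induction B with
  | nil =>
    simp [Crossing.move, Crossing.refl_hom, wireAppend, wireTensor, wireSwap]
  | cons b B ih =>
    have key : ∀ {Q B R S : C} (f : X a ⊗ S ⟶ Q) (s : S ⟶ B ⊗ R) (q : Q ⟶ B ⊗ (X a ⊗ R)),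
        f ≫ q = X a ◁ s ≫ wireSwap (X a) B R →
        (wireSwap (X a) (X b) S ≫ X b ◁ f) ≫ X b ◁ q ≫ (α_ (X b) B (X a ⊗ R)).inv =
          X a ◁ (X b ◁ s ≫ (α_ (X b) B R).inv) ≫ wireSwap (X a) (X b ⊗ B) R := by
      intro Q B R S f s q h
      rw [Category.assoc, ← MonoidalCategory.whiskerLeft_comp_assoc, h,
        MonoidalCategory.whiskerLeft_comp_assoc, ← reassoc_of% @wireSwap_naturality,
        wireSwap_tensor,
        MonoidalCategory.whiskerLeft_comp_assoc]
    exact key _ _ _ ih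

/-- By the hexagon identity, braiding `X a ⊗ A` past `B` means first braiding `A` past `B` and then
moving `X a` across `B`. -/
theorem Crossing.block_hom (A B : List E) :
    (Crossing.block A B).hom X ≫ (wireAppend X B A).hom =
      (wireAppend X A B).hom ≫ (β_ (wireTensor X A) (wireTensor X B)).hom := by
  induction A with
  | nil =>
    refine (Crossing.appendNil_hom X B).trans ?_
    simp [wireAppend, wireTensor]
  | cons a A ih =>
    have key : ∀ {P Q N A B : C} (f : P ⟶ Q) (p : P ⟶ A ⊗ B) (q : Q ⟶ B ⊗ A) (m : X a ⊗ Q ⟶ N)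
        (n : N ⟶ B ⊗ (X a ⊗ A)), f ≫ q = p ≫ (β_ A B).hom →
        m ≫ n = X a ◁ q ≫ wireSwap (X a) B A →
        (X a ◁ f ≫ m) ≫ n = (X a ◁ p ≫ (α_ (X a) A B).inv) ≫ (β_ (X a ⊗ A) B).hom := by
      intro P Q N A B f p q m n h h'
      rw [Category.assoc, h', ← MonoidalCategory.whiskerLeft_comp_assoc, h, wireSwap,
        BraidedCategory.braiding_tensor_left_hom]
      simp
    exact key _ _ _ _ _ ih (Crossing.move_hom X a B A)

variable {X}

/-- A morphism between objects that are interpreted as tensor products of wires is structural if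
it is drawn by a crossing of these wires. -/
def Structural {Z Z' : C} {l l' : List E} (φ : Z ≅ wireTensor X l) (ψ : Z' ≅ wireTensor X l')
    (f : Z ⟶ Z') : Prop :=
  ∃ c : Crossing l l', φ.hom ≫ c.hom X = f ≫ ψ.hom

namespace Structural

variable {Z Z' Z'' W W' : C} {l l' l'' k k' : List E} {φ : Z ≅ wireTensor X l}
  {ψ : Z' ≅ wireTensor X l'} {χ : Z'' ≅ wireTensor X l''} {ω : W ≅ wireTensor X k}
  {ω' : W' ≅ wireTensor X k'}

/-- This is the form in which coherence is applied: two composites of structural maps agree as soon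
as their ends are identified with the same lists of distinct wires. -/
theorem unique {f g : Z ⟶ Z'} (hf : Structural φ ψ f) (hg : Structural φ ψ g) (hl : l.Nodup) :
    f = g := by
  obtain ⟨c, hc⟩ := hf
  obtain ⟨d, hd⟩ := hg
  rw [← cancel_mono ψ.hom, ← hc, ← hd, c.hom_eq X hl d]

theorem exists_of_perm (φ : Z ≅ wireTensor X l) (ψ : Z' ≅ wireTensor X l') (h : l.Perm l') :
    ∃ f : Z ⟶ Z', Structural φ ψ f := by
  obtain ⟨c⟩ := Crossing.nonempty_of_perm h
  exact ⟨φ.hom ≫ c.hom X ≫ ψ.inv, c, by simp⟩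

theorem perm {f : Z ⟶ Z'} (hf : Structural φ ψ f) : l.Perm l' := hf.choose.perm

theorem id (φ : Z ≅ wireTensor X l) : Structural φ φ (𝟙 Z) :=
  ⟨Crossing.refl l, by simp [Crossing.refl_hom]⟩

theorem comp {f : Z ⟶ Z'} {g : Z' ⟶ Z''} (hf : Structural φ ψ f) (hg : Structural ψ χ g) :
    Structural φ χ (f ≫ g) := by
  obtain ⟨c, hc⟩ := hf
  obtain ⟨d, hd⟩ := hg
  exact ⟨.trans c d, by simp only [Crossing.hom]; rw [reassoc_of% hc, hd, Category.assoc]⟩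

theorem exists_inv {f : Z ⟶ Z'} (hf : Structural φ ψ f) :
    ∃ g : Z' ⟶ Z, Structural ψ φ g ∧ f ≫ g = 𝟙 Z ∧ g ≫ f = 𝟙 Z' := by
  obtain ⟨c, hc⟩ := hf
  have hf : f = φ.hom ≫ c.hom X ≫ ψ.inv := by rw [reassoc_of% hc]; simp
  refine ⟨ψ.hom ≫ c.symm.hom X ≫ φ.inv, ⟨c.symm, by simp⟩, ?_, ?_⟩
  · simp [hf, reassoc_of% @Crossing.hom_symm]
  · simp [hf, reassoc_of% @Crossing.symm_hom]

theorem iso_inv {f : Z ≅ Z'} (hf : Structural φ ψ f.hom) : Structural ψ φ f.inv := by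
  obtain ⟨g, hg, h, -⟩ := hf.exists_inv
  rwa [(Iso.eq_inv_comp f).2 h, Category.comp_id] at hg

theorem whiskerLeft (ω : W ≅ wireTensor X k) {f : Z ⟶ Z'} (hf : Structural φ ψ f) :
    Structural (wireTensorIso X ω φ) (wireTensorIso X ω ψ) (W ◁ f) := by
  obtain ⟨c, hc⟩ := hf
  refine ⟨c.left k, ?_⟩
  rw [← cancel_mono (wireAppend X k l').hom]
  simp only [wireTensorIso, Iso.trans_hom, Iso.symm_hom, Category.assoc, Crossing.left_hom,
    Iso.inv_hom_id_assoc, Iso.inv_hom_id, Category.comp_id, tensorIso_hom, MonoidalCategory.tensorHom_def]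
  rw [← MonoidalCategory.whiskerLeft_comp, hc, MonoidalCategory.whiskerLeft_comp,
    whisker_exchange_assoc]

theorem whiskerRight (ω : W ≅ wireTensor X k) {f : Z ⟶ Z'} (hf : Structural φ ψ f) :
    Structural (wireTensorIso X φ ω) (wireTensorIso X ψ ω) (f ▷ W) := by
  obtain ⟨c, hc⟩ := hf
  refine ⟨c.right k, ?_⟩
  rw [← cancel_mono (wireAppend X l' k).hom]
  simp only [wireTensorIso, Iso.trans_hom, Iso.symm_hom, Category.assoc, Crossing.right_hom,
    Iso.inv_hom_id_assoc, Iso.inv_hom_id, Category.comp_id, tensorIso_hom, tensorHom_def']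
  rw [← comp_whiskerRight, hc, comp_whiskerRight, whisker_exchange_assoc]

theorem associator (φ : Z ≅ wireTensor X l) (ψ : Z' ≅ wireTensor X l')
    (χ : Z'' ≅ wireTensor X l'') :
    Structural (wireTensorIso X (wireTensorIso X φ ψ) χ) (wireTensorIso X φ (wireTensorIso X ψ χ))
      (α_ Z Z' Z'').hom := by
  refine ⟨Crossing.assoc l l' l'', ?_⟩
  rw [← cancel_mono (wireAppend X l (l' ++ l'')).hom,
    ← cancel_mono (wireTensor X l ◁ (wireAppend X l' l'').hom)]
  simp only [wireTensorIso, Iso.trans_hom, Iso.symm_hom, Category.assoc, Crossing.assoc_hom,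
    tensorIso_hom, Iso.inv_hom_id_assoc]
  simp only [MonoidalCategory.tensorHom_def, comp_whiskerRight, MonoidalCategory.whiskerLeft_comp,
    Category.assoc]
  rw [← whisker_exchange_assoc, ← comp_whiskerRight_assoc (wireAppend X l l').inv,
    Iso.inv_hom_id, ← MonoidalCategory.whiskerLeft_comp, Iso.inv_hom_id]
  monoidal

theorem braiding (φ : Z ≅ wireTensor X l) (ψ : Z' ≅ wireTensor X l') :
    Structural (wireTensorIso X φ ψ) (wireTensorIso X ψ φ) (β_ Z Z').hom := by
  refine ⟨Crossing.block l l', ?_⟩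
  rw [← cancel_mono (wireAppend X l' l).hom]
  simp only [wireTensorIso, Iso.trans_hom, Iso.symm_hom, Category.assoc, Crossing.block_hom,
    tensorIso_hom, Iso.inv_hom_id_assoc, Iso.inv_hom_id, Category.comp_id]
  exact BraidedCategory.braiding_naturality _ _

theorem leftUnitor (φ : Z ≅ wireTensor X l) :
    Structural (wireTensorIso X (Iso.refl (wireTensor X [])) φ) φ (λ_ Z).hom := by
  refine ⟨Crossing.refl l, ?_⟩
  simp [Crossing.refl_hom, wireTensorIso, wireAppend, wireTensor]

theorem wireAppend_hom (l l' : List E) :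
    Structural (Iso.refl (wireTensor X (l ++ l')))
      (wireTensorIso X (Iso.refl (wireTensor X l)) (Iso.refl (wireTensor X l')))
      (wireAppend X l l').hom :=
  ⟨Crossing.refl _, by simp [Crossing.refl_hom, wireTensorIso]⟩

theorem crossing_hom (c : Crossing l l') :
    Structural (Iso.refl (wireTensor X l)) (Iso.refl (wireTensor X l')) (c.hom X) :=
  ⟨c, by simp⟩

variable {F : Type*} {Y : F → C} {L : F → List E} (θ : ∀ e, Y e ≅ wireTensor X (L e))

/-- Crossing two bundles crosses all the wires they contain: a swap becomes the braiding of two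
tensor products, which is itself drawn by a block crossing. -/
theorem bundle_crossing {m m' : List F} (c : Crossing m m') :
    Structural (bundleIso X θ m) (bundleIso X θ m') (c.hom Y) := by
  induction c with
  | nil => exact id _
  | cons a c ih => exact ih.whiskerLeft (θ a)
  | swap a b l =>
    exact ((associator (θ a) (θ b) (bundleIso X θ l)).iso_inv).comp
      (((braiding (θ a) (θ b)).whiskerRight (bundleIso X θ l)).comp
        (associator (θ b) (θ a) (bundleIso X θ l)))
  | trans c d hc hd => exact hc.comp hd

theorem bundle_wireAppend (m m' : List F) :
    Structural (bundleIso X θ (m ++ m')) (wireTensorIso X (bundleIso X θ m) (bundleIso X θ m'))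
      (wireAppend Y m m').hom := by
  induction m with
  | nil => exact (leftUnitor (bundleIso X θ m')).iso_inv
  | cons a m ih =>
    exact (ih.whiskerLeft (θ a)).comp
      (associator (θ a) (bundleIso X θ m) (bundleIso X θ m')).iso_inv

end Structural

end Structural
-- Paths and routings in acyclic graphs
namespace Digraph

variable {V : Type*}

theorem Acyclic.source_ne_target {G : Digraph V} (hG : G.Acyclic) (e : G.Edge) :
    e.source ≠ e.target := fun he =>
  hG e.source (.single (by have := e.2; rwa [show e.1.2 = e.1.1 from he.symm] at this))

/-- The edges and nodes of a directed path between two nodes of an acyclic graph. -/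
theorem Acyclic.exists_path {G : Digraph V} (hG : G.Acyclic) {a b : V} (h : G.Reaches a b) :
    ∃ (S : Set G.Edge) (W : Set V), a ∈ W ∧ b ∈ W ∧
      (∀ v, (∃ e ∈ S, e.target = v) ↔ v ∈ W ∧ v ≠ a) ∧
      (∀ v, (∃ e ∈ S, e.source = v) ↔ v ∈ W ∧ v ≠ b) ∧
      (∀ e ∈ S, ∀ e' ∈ S, e.target = e'.target → e = e') ∧
      (∀ e ∈ S, ∀ e' ∈ S, e.source = e'.source → e = e') ∧
      ∀ w ∈ W, w = b ∨ G.Reaches w b := by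
  induction h with
  | single h =>
    rename_i b
    have hab : a ≠ b := by
      rintro rfl
      exact hG a (.single h)
    refine ⟨{⟨(a, b), h⟩}, {a, b}, by simp, by simp, ?_, ?_, ?_, ?_, ?_⟩
    · intro v
      simp only [Set.mem_singleton_iff, exists_eq_left, Edge.target, Set.mem_insert_iff]
      grind
    · intro v
      simp only [Set.mem_singleton_iff, exists_eq_left, Edge.source, Set.mem_insert_iff]
      grind
    · rintro e rfl e' rfl -; rfl
    · rintro e rfl e' rfl -; rfl
    · rintro w (rfl | rfl)
      · exact Or.inr (.single h)
      · exact Or.inl rfl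
  | tail _ hbc ih =>
    rename_i b c _
    obtain ⟨S, W, haW, hbW, hin, hout, htgt, hsrc, hreach⟩ := ih
    -- Every node visited so far is `b` or reaches `b`, so returning to one of them would close a
    -- cycle. This is why the last invariant is carried along: it keeps the path simple.
    have hcW : c ∉ W := by
      intro hc
      rcases hreach c hc with rfl | hcb
      · exact hG c (.single hbc)
      · exact hG c (.tail hcb hbc)
    have hac : a ≠ c := by rintro rfl; exact hcW haW
    have hbc' : b ≠ c := by rintro rfl; exact hcW hbW
    refine ⟨insert ⟨(b, c), hbc⟩ S, insert c W, by simp [haW], by simp, ?_, ?_, ?_, ?_, ?_⟩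
    · intro v
      have := hin v
      simp only [Set.mem_insert_iff, exists_eq_or_imp, this]
      simp only [Edge.target]
      grind
    · intro v
      have := hout v
      simp only [Set.mem_insert_iff, exists_eq_or_imp, this]
      simp only [Edge.source]
      grind
    · rintro e (rfl | he) e' (rfl | he') h
      · rfl
      · exact absurd ((hin c).1 ⟨e', he', h.symm⟩).1 hcW
      · exact absurd ((hin c).1 ⟨e, he, h⟩).1 hcW
      · exact htgt e he e' he' h
    · rintro e (rfl | he) e' (rfl | he') h
      · rfl
      · exact absurd rfl ((hout b).1 ⟨e', he', h.symm⟩).2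
      · exact absurd rfl ((hout b).1 ⟨e, he, h⟩).2
      · exact hsrc e he e' he' h
    · rintro w (rfl | hw)
      · exact Or.inl rfl
      · rcases hreach w hw with rfl | h
        · exact Or.inr (.single hbc)
        · exact Or.inr (.tail h hbc)

/-- A routing of the edges of one graph along the edges of another graph: every edge of the second
graph carries a bundle of edges of the first graph, and every node is passed by a list of edges. -/
structure Routing {G G' : Digraph V} (p : G.Polarization) (p' : G'.Polarization) where
  /-- the edges carried by an edge of the second graph -/
  bundle : G'.Edge → List G.Edge
  /-- the edges that pass a node without ending or starting there -/
  through : V → List G.Edge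
  ins_perm : ∀ v, ((p'.ins v).flatMap bundle).Perm (p.ins v ++ through v)
  outs_perm : ∀ v, (p.outs v ++ through v).Perm ((p'.outs v).flatMap bundle)

/-- Choose a simple path in `G'` for each edge of `G`. An edge of `G'` carries the edges whose paths
use it, and a node is passed by the edges for which it is an interior node of the path. A path
entering a node either ends there or passes it, and a path leaving it either starts there or passes
it. Simplicity excludes repetitions in the lists. -/
theorem Routing.nonempty [Finite V] {G G' : Digraph V} (hG : G.Acyclic) (hG' : G'.Acyclic)
    (h : ∀ u w, G.Reaches u w → G'.Reaches u w) (p : G.Polarization) (p' : G'.Polarization) :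
    Nonempty (Routing p p') := by
  classical
  have : Finite G.Edge := Subtype.finite
  have := Fintype.ofFinite G.Edge
  choose S W hsW htW hin hout htgt hsrc _ using fun e : G.Edge =>
    hG'.exists_path (h e.source e.target (.single e.2))
  -- Since `G` has no loops, the nodes of a path other than its start are exactly its end and its
  -- interior nodes, and dually for the nodes other than its end.
  have hst := hG.source_ne_target
  let L : G'.Edge → List G.Edge := fun e' => (Finset.univ.filter fun e => e' ∈ S e).toList
  have hL : ∀ e e', e ∈ L e' ↔ e' ∈ S e := by simp [L]
  have nodup_bundle : ∀ k : List G'.Edge, k.Nodup →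
      (∀ e, ∀ e₁ ∈ k, ∀ e₂ ∈ k, e₁ ∈ S e → e₂ ∈ S e → e₁ = e₂) → (k.flatMap L).Nodup := by
    intro k hk hu
    refine List.nodup_flatMap.2 ⟨fun e' _ => Finset.nodup_toList _, ?_⟩
    refine hk.pairwise_of_forall_ne fun e₁ h₁ e₂ h₂ hne => ?_
    intro e he₁ he₂
    exact hne (hu e e₁ h₁ e₂ h₂ ((hL _ _).1 he₁) ((hL _ _).1 he₂))
  let T : V → List G.Edge := fun v =>
    (Finset.univ.filter fun e => v ∈ W e ∧ v ≠ e.source ∧ v ≠ e.target).toList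
  have hT : ∀ e v, e ∈ T v ↔ v ∈ W e ∧ v ≠ e.source ∧ v ≠ e.target := by simp [T]
  refine ⟨⟨L, T, fun v => ?_, fun v => ?_⟩⟩
  · refine (List.perm_ext_iff_of_nodup ?_ ?_).2 fun e => ?_
    · refine nodup_bundle _ (p'.nodup_ins v) fun e e₁ h₁ e₂ h₂ h₁' h₂' => ?_
      rw [p'.mem_ins] at h₁ h₂
      exact htgt e e₁ h₁' e₂ h₂' (h₁.trans h₂.symm)
    · refine List.Nodup.append (p.nodup_ins v) (Finset.nodup_toList _) fun e h₁ h₂ => ?_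
      exact ((hT e v).1 h₂).2.2 ((p.mem_ins v e).1 h₁).symm
    · have := hin e v
      simp only [List.mem_flatMap, List.mem_append, hL, hT, p.mem_ins, p'.mem_ins]
      grind
  · refine (List.perm_ext_iff_of_nodup ?_ ?_).2 fun e => ?_
    · refine List.Nodup.append (p.nodup_outs v) (Finset.nodup_toList _) fun e h₁ h₂ => ?_
      exact ((hT e v).1 h₂).2.1 ((p.mem_outs v e).1 h₁).symm
    · refine nodup_bundle _ (p'.nodup_outs v) fun e e₁ h₁ e₂ h₂ h₁' h₂' => ?_
      rw [p'.mem_outs] at h₁ h₂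
      exact hsrc e e₁ h₁' e₂ h₂' (h₁.trans h₂.symm)
    · have := hout e v
      simp only [List.mem_flatMap, List.mem_append, hL, hT, p.mem_outs, p'.mem_outs]
      grind

theorem Reaches.mem_of_closed {G : Digraph V} {vs : List V}
    (hvs : ∀ e : G.Edge, e.target ∈ vs → e.source ∈ vs) {u w : V} (h : G.Reaches u w)
    (hw : w ∈ vs) : u ∈ vs := by
  induction h with
  | single h => exact hvs ⟨(_, _), h⟩ hw
  | tail _ h ih => exact ih (hvs ⟨(_, _), h⟩ hw)

/-- Each use of the new edge can be replaced by the detour through `v`. -/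
theorem addEdge_reaches_iff {G : Digraph V} {u v w : V} (huv : G.Adj u v) (hvw : G.Adj v w)
    (a b : V) : (G.addEdge u w).Reaches a b ↔ G.Reaches a b := by
  constructor
  · intro h
    induction h with
    | single h =>
      rcases h with h | ⟨rfl, rfl⟩
      · exact .single h
      · exact .tail (.single huv) hvw
    | tail _ h ih =>
      rcases h with h | ⟨rfl, rfl⟩
      · exact .tail ih h
      · exact .tail (.tail ih huv) hvw
  · exact Relation.TransGen.mono (fun _ _ => Or.inl) a b

end Digraph

/-! ### Following an evaluation along a routing -/

section Simulation

variable {C : Type*} [Category C] [MonoidalCategory C] [SymmetricCategory C]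
  {V : Type*} {G G' : Digraph V} {p : G.Polarization} {p' : G'.Polarization}

/-- The wires left open by the initial part of an acyclic graph are the edges that leave it. -/
theorem Evaluates.openWires (hG : G.Acyclic) {X : G.Edge → C}
    {g : ∀ v, wireTensor X (p.ins v) ⟶ wireTensor X (p.outs v)} {vs : List V} {l : List G.Edge}
    {m : 𝟙_ C ⟶ wireTensor X l} (h : Evaluates p X g vs l m) :
    l.Nodup ∧ (∀ e, e ∈ l ↔ e.source ∈ vs ∧ e.target ∉ vs) ∧
      ∀ e : G.Edge, e.target ∈ vs → e.source ∈ vs := by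
  induction h with
  | empty => simp
  | @node v vs l m rest r hv _ ih =>
    obtain ⟨hnd, hmem, hclosed⟩ := ih
    have hmem' : ∀ e, e.target = v ∨ e ∈ rest ↔ e.source ∈ vs ∧ e.target ∉ vs := fun e => by
      rw [← hmem, r.perm.mem_iff, List.mem_append, p.mem_ins]
    have hnd' := List.nodup_append'.1 (r.perm.nodup_iff.1 hnd)
    have hne : ∀ e ∈ rest, e.target ≠ v := fun e he h =>
      hnd'.2.2 ((p.mem_ins v e).2 h) he
    have hst := hG.source_ne_target
    refine ⟨?_, ?_, ?_⟩
    · refine List.Nodup.append (p.nodup_outs v) hnd'.2.1 fun e h₁ h₂ => ?_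
      rw [p.mem_outs] at h₁
      exact hv (h₁ ▸ ((hmem' e).1 (Or.inr h₂)).1)
    · intro e
      have h1 := hmem' e
      have h2 := hne e
      have h3 := hst e
      have h4 := hclosed e
      rw [List.mem_append, p.mem_outs, List.mem_cons, List.mem_cons]
      grind
    · intro e
      have h1 := hmem' e
      have h4 := hclosed e
      rw [List.mem_cons, List.mem_cons]
      grind

/-- If the edges of `G` are routed along the edges of `G'`, the evaluation of a labelled graph `G`
can be followed in `G'`, where every node also forwards the wires that pass it. -/
theorem Evaluates.simulate (hG : G.Acyclic) (hG' : G'.Acyclic)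
    (hGG' : ∀ u w, G'.Reaches u w → G.Reaches u w) (R : Digraph.Routing p p') {X : G.Edge → C}
    {Y : G'.Edge → C} (θ : ∀ e, Y e ≅ wireTensor X (R.bundle e))
    {g : ∀ v, wireTensor X (p.ins v) ⟶ wireTensor X (p.outs v)}
    {s : ∀ v, wireTensor Y (p'.ins v) ⟶ wireTensor X (p.ins v) ⊗ wireTensor X (R.through v)}
    {t : ∀ v, wireTensor X (p.outs v) ⊗ wireTensor X (R.through v) ⟶ wireTensor Y (p'.outs v)}
    (hs : ∀ v, Structural (bundleIso X θ (p'.ins v))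
      (wireTensorIso X (Iso.refl _) (Iso.refl _)) (s v))
    (ht : ∀ v, Structural (wireTensorIso X (Iso.refl _) (Iso.refl _))
      (bundleIso X θ (p'.outs v)) (t v))
    {vs : List V} {l : List G.Edge} {m : 𝟙_ C ⟶ wireTensor X l} (h : Evaluates p X g vs l m) :
    ∃ (l' : List G'.Edge) (c : wireTensor X l ⟶ wireTensor Y l'),
      Evaluates p' Y (fun v => s v ≫ g v ▷ wireTensor X (R.through v) ≫ t v) vs l' (m ≫ c) ∧
      Structural (Iso.refl _) (bundleIso X θ l') c := by
  classical
  induction h with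
  | empty =>
    refine ⟨[], 𝟙 (𝟙_ C), ?_, Structural.id _⟩
    have := Evaluates.empty (p := p') (X := Y)
      (g := fun v => s v ≫ g v ▷ wireTensor X (R.through v) ≫ t v)
    rwa [← Category.comp_id (𝟙 (𝟙_ C))] at this
  | @node v vs l m rest r hv hev ih =>
    obtain ⟨l', c, hev', hc⟩ := ih
    obtain ⟨hnd, hmem, hclosed⟩ := hev.openWires hG
    obtain ⟨hnd', hmem', -⟩ := hev'.openWires hG'
    -- The source of a `G'`-edge into `v` reaches `v` in `G`. All direct predecessors of `v` in `G`
    -- have been placed, and the placed nodes are closed under predecessors, so this source has been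
    -- placed as well.
    have hsub : ∀ e, e ∈ p'.ins v → e ∈ l' := by
      intro e he
      rw [p'.mem_ins] at he
      refine (hmem' e).2 ⟨?_, he ▸ hv⟩
      have hreach : G.Reaches e.source v := by
        have := hGG' _ _ (.single e.2)
        rwa [show e.1.2 = v from he] at this
      have hins : ∀ b, G.Adj b v → b ∈ vs := fun b hb =>
        ((hmem ⟨(b, v), hb⟩).1 (r.perm.mem_iff.2
          (List.mem_append_left _ ((p.mem_ins _ _).2 rfl)))).1
      cases hreach with
      | single h => exact hins _ h
      | tail h h' => exact Digraph.Reaches.mem_of_closed hclosed h (hins _ h')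
    obtain ⟨rest', hrest'⟩ : ∃ rest', l'.Perm (p'.ins v ++ rest') := by
      obtain ⟨l₀, h₀, h₁⟩ := List.subperm_of_subset (p'.nodup_ins v) hsub
      obtain ⟨rest', h₂⟩ := h₁.exists_perm_append
      exact ⟨rest', h₂.trans (h₀.append_right _)⟩
    obtain ⟨r'⟩ := Crossing.nonempty_of_perm hrest'
    -- The left half of the step in `G'`: from the open wires of `G` to the inputs of `g v`, the
    -- wires passing `v`, and the remaining bundles.
    have hstart := (((hc.comp (Structural.bundle_crossing θ r')).comp
      (Structural.bundle_wireAppend θ _ _)).comp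
        ((hs v).whiskerRight (bundleIso X θ rest'))).comp (Structural.associator _ _ _)
    -- Cancelling the inputs of `v`, the wires untouched in `G` are those that pass `v` together
    -- with those in the untouched bundles; `k` rearranges them accordingly.
    have hperm : rest.Perm (R.through v ++ rest'.flatMap R.bundle) :=
      (List.perm_append_left_iff (p.ins v)).1 (r.perm.symm.trans hstart.perm)
    obtain ⟨k, hk⟩ := Structural.exists_of_perm (Iso.refl (wireTensor X rest))
      (wireTensorIso X (Iso.refl (wireTensor X (R.through v))) (bundleIso X θ rest')) hperm
    -- Coherence applies because the open wires `l` are distinct: preparing the inputs in `G'` is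
    -- the same as preparing them in `G` and then applying `k` to the rest.
    have hcoh := hstart.unique (((Structural.crossing_hom r).comp
      (Structural.wireAppend_hom _ _)).comp (hk.whiskerLeft (Iso.refl _))) hnd
    -- The composite proved structural here is the comparison map after `v` has been placed, which
    -- supplies the witness left open below.
    have hend := ((((Structural.wireAppend_hom (X := X) (p.outs v) rest).comp
      (hk.whiskerLeft (Iso.refl _))).comp (Structural.associator _ _ _).iso_inv).comp
        ((ht v).whiskerRight (bundleIso X θ rest'))).comp
          (Structural.bundle_wireAppend θ _ _).iso_inv
    refine ⟨p'.outs v ++ rest', _, ?_, hend⟩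
    convert Evaluates.node v rest' r' hv hev' using 1
    simp only [Category.assoc] at hcoh
    simp only [Category.assoc, comp_whiskerRight, Iso.inv_hom_id_assoc]
    rw [whiskerRight_tensor_symm]
    congr 1
    simp only [Category.assoc]
    -- `g v` and `k` act on different tensor factors, so they can be interchanged.
    rw [reassoc_of% hcoh, whisker_exchange_assoc]

end Simulation
-- Normalization of rearrangements and of the new instruments
section Normalized

variable {C : Type*} [Category C] [MonoidalCategory C] [SymmetricCategory C] [OperationCategory C]

namespace OperationCategory

theorem sum_comp {ι : Type*} (A : Finset ι) {X Y Z : C} (f : ι → (X ⟶ Y)) (g : Y ⟶ Z) :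
    (∑ i ∈ A, f i) ≫ g = ∑ i ∈ A, f i ≫ g := by
  let φ : (X ⟶ Y) →+ (X ⟶ Z) :=
    { toFun := fun f => f ≫ g
      -- Absorption of zero is not an axiom; it comes from compatibility with the scalar `0`.
      map_zero' := by rw [← zero_smul ℝ≥0 (0 : X ⟶ Y), smul_comp, zero_smul]
      map_add' := fun f f' => add_comp f f' g }
  exact map_sum φ f A

theorem comp_sum {ι : Type*} (A : Finset ι) {X Y Z : C} (f : X ⟶ Y) (g : ι → (Y ⟶ Z)) :
    f ≫ (∑ i ∈ A, g i) = ∑ i ∈ A, f ≫ g i := by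
  let φ : (Y ⟶ Z) →+ (X ⟶ Z) :=
    { toFun := fun g => f ≫ g
      map_zero' := by rw [← zero_smul ℝ≥0 (0 : Y ⟶ Z), comp_smul, zero_smul]
      map_add' := comp_add f }
  exact map_sum φ g A

theorem sum_whiskerRight {ι : Type*} (A : Finset ι) {X Y : C} (f : ι → (X ⟶ Y)) (Z : C) :
    (∑ i ∈ A, f i) ▷ Z = ∑ i ∈ A, f i ▷ Z := by
  let φ : (X ⟶ Y) →+ (X ⊗ Z ⟶ Y ⊗ Z) :=
    { toFun := fun f => f ⊗ₘ 𝟙 Z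
      map_zero' := by rw [← zero_smul ℝ≥0 (0 : X ⟶ Y), smul_tensorHom, zero_smul]
      map_add' := fun f f' => add_tensorHom f f' (𝟙 Z) }
  simpa only [φ, AddMonoidHom.coe_mk, ZeroHom.coe_mk, tensorHom_id] using map_sum φ f A

attribute [local instance] normalized_symmetricMonoidal

variable {E : Type*} (X : E → C)

theorem normalized_crossing {l l' : List E} (c : Crossing l l') : normalized (c.hom X) := by
  induction c with
  | nil => exact normalized.id_mem _
  | cons a c ih => exact normalized.whiskerLeft_mem _ _ ih
  | swap a b l =>
    exact normalized.comp_mem _ _ (normalized.associator_inv_mem _ _ _)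
      (normalized.comp_mem _ _ (normalized.whiskerRight_mem _ (normalized.braiding_hom_mem _ _) _)
        (normalized.associator_hom_mem _ _ _))
  | trans c d hc hd => exact normalized.comp_mem _ _ hc hd

theorem normalized_wireAppend (l l' : List E) :
    normalized (wireAppend X l l').hom ∧ normalized (wireAppend X l l').inv := by
  induction l with
  | nil => exact ⟨normalized.leftUnitor_inv_mem _, normalized.leftUnitor_hom_mem _⟩
  | cons a l ih =>
    exact ⟨normalized.comp_mem _ _ (normalized.whiskerLeft_mem _ _ ih.1)
      (normalized.associator_inv_mem _ _ _),
      normalized.comp_mem _ _ (normalized.associator_hom_mem _ _ _)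
        (normalized.whiskerLeft_mem _ _ ih.2)⟩

variable {X}

theorem normalized_wireTensorIso {Z Z' : C} {l l' : List E} {φ : Z ≅ wireTensor X l}
    {ψ : Z' ≅ wireTensor X l'} (hφ : normalized φ.hom ∧ normalized φ.inv)
    (hψ : normalized ψ.hom ∧ normalized ψ.inv) :
    normalized (wireTensorIso X φ ψ).hom ∧ normalized (wireTensorIso X φ ψ).inv :=
  ⟨normalized.comp_mem _ _ (normalized.tensorHom_mem _ _ hφ.1 hψ.1)
    (normalized_wireAppend X l l').2,
    normalized.comp_mem _ _ (normalized_wireAppend X l l').1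
      (normalized.tensorHom_mem _ _ hφ.2 hψ.2)⟩

theorem normalized_refl (Z : C) : normalized (Iso.refl Z).hom ∧ normalized (Iso.refl Z).inv :=
  ⟨normalized.id_mem _, normalized.id_mem _⟩

theorem normalized_bundleIso {F : Type*} {Y : F → C} {L : F → List E}
    {θ : ∀ e, Y e ≅ wireTensor X (L e)} (hθ : ∀ e, normalized (θ e).hom ∧ normalized (θ e).inv)
    (k : List F) : normalized (bundleIso X θ k).hom ∧ normalized (bundleIso X θ k).inv := by
  induction k with
  | nil => exact normalized_refl _
  | cons e k ih => exact normalized_wireTensorIso (hθ e) ih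

theorem normalized_of_structural {Z Z' : C} {l l' : List E} {φ : Z ≅ wireTensor X l}
    {ψ : Z' ≅ wireTensor X l'} {f : Z ⟶ Z'} (hf : Structural φ ψ f) (hφ : normalized φ.hom)
    (hψ : normalized ψ.inv) : normalized f := by
  obtain ⟨c, hc⟩ := hf
  rw [show f = (φ.hom ≫ c.hom X) ≫ ψ.inv by rw [hc]; simp]
  exact normalized.comp_mem _ _ (normalized.comp_mem _ _ hφ (normalized_crossing X c)) hψ

end OperationCategory

open OperationCategory

attribute [local instance] normalized_symmetricMonoidal in
-- By bilinearity the sum over outcomes moves inside, leaving a composite of normalized operations.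
theorem IsInstrument.sandwich {O : Type*} [Fintype O] {X Y W Z Z' : C} {f : O → (X ⟶ Y)}
    (hf : IsInstrument f) {s : Z ⟶ X ⊗ W} {t : Y ⊗ W ⟶ Z'} (hs : normalized s)
    (ht : normalized t) : IsInstrument fun o => s ≫ f o ▷ W ≫ t := by
  unfold IsInstrument
  rw [← comp_sum, ← sum_comp, ← OperationCategory.sum_whiskerRight]
  exact normalized.comp_mem _ _ hs
    (normalized.comp_mem _ _ (normalized.whiskerRight_mem _ hf _) ht)

end Normalized

/-! ### Transfer of correlations and the theorem -/

theorem correlations_subset (C : Type*) [Category C] [MonoidalCategory C] [SymmetricCategory C]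
    [OperationCategory C] {V : Type*} [Finite V] (O : V → Type*) [∀ v, Fintype (O v)]
    {G G' : Digraph V} (hG : G.Acyclic) (hG' : G'.Acyclic)
    (h : ∀ u w, G.Reaches u w ↔ G'.Reaches u w) (p : G.Polarization) (p' : G'.Polarization) :
    correlations C G p O ⊆ correlations C G' p' O := by
  rintro P ⟨X, f, hf, hP⟩
  obtain ⟨R⟩ := Digraph.Routing.nonempty hG hG' (fun u w => (h u w).1) p p'
  let Y : G'.Edge → C := fun e => wireTensor X (R.bundle e)
  let θ : ∀ e, Y e ≅ wireTensor X (R.bundle e) := fun e => Iso.refl _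
  have hθ := OperationCategory.normalized_bundleIso (θ := θ)
    fun e => OperationCategory.normalized_refl _
  have hpair := fun l l' : List G.Edge => OperationCategory.normalized_wireTensorIso
    (OperationCategory.normalized_refl (wireTensor X l))
    (OperationCategory.normalized_refl (wireTensor X l'))
  choose s hs using fun v => Structural.exists_of_perm (bundleIso X θ (p'.ins v))
    (wireTensorIso X (Iso.refl (wireTensor X (p.ins v))) (Iso.refl (wireTensor X (R.through v))))
    (R.ins_perm v)
  choose t ht using fun v => Structural.exists_of_perm
    (wireTensorIso X (Iso.refl (wireTensor X (p.outs v))) (Iso.refl (wireTensor X (R.through v))))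
    (bundleIso X θ (p'.outs v)) (R.outs_perm v)
  refine ⟨Y, fun v o => s v ≫ f v o ▷ wireTensor X (R.through v) ≫ t v, fun v => ?_, fun o => ?_⟩
  · exact (hf v).sandwich
      (OperationCategory.normalized_of_structural (hs v) (hθ _).1 (hpair _ _).2)
      (OperationCategory.normalized_of_structural (ht v) (hpair _ _).1 (hθ _).2)
  · obtain ⟨vs, hvs, hev⟩ := hP o
    obtain ⟨l', c, hev', hc⟩ := hev.simulate hG hG' (fun u w => (h u w).2) R θ hs ht
    -- An open wire would have a target not yet placed, but all nodes have been placed.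
    obtain rfl : l' = [] := List.eq_nil_iff_forall_not_mem.2 fun e he =>
      (((hev'.openWires hG').2.1 e).1 he).2 (hvs _)
    have hone : Structural (Iso.refl (wireTensor X [])) (bundleIso X θ []) (𝟙 (𝟙_ C)) :=
      Structural.id _
    -- With no wires left, coherence forces the comparison map to be the identity of the unit, so
    -- the two values agree.
    obtain rfl := hc.unique hone List.nodup_nil
    refine ⟨vs, hvs, ?_⟩
    have hid := Category.comp_id (P o • 𝟙 (𝟙_ C))
    rw [← hid]
    exact hev'

theorem mainTheorem4
    (C : Type*) [Category C] [MonoidalCategory C] [SymmetricCategory C] [OperationCategory C]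
    {V : Type*} [Finite V] (O : V → Type*) [∀ v, Fintype (O v)] :
    (∀ G G' : Digraph V, G.Acyclic → G'.Acyclic →
      (∀ u w, G.Reaches u w ↔ G'.Reaches u w) →
      ∀ (p : G.Polarization) (p' : G'.Polarization),
        correlations C G p O = correlations C G' p' O) ∧
    (∀ G : Digraph V, G.Acyclic → ∀ u v w, G.Adj u v → G.Adj v w →
      (G.addEdge u w).Acyclic ∧
      ∀ (p : G.Polarization) (p' : (G.addEdge u w).Polarization),
        correlations C G p O = correlations C (G.addEdge u w) p' O) := by
  have key : ∀ G G' : Digraph V, G.Acyclic → G'.Acyclic →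
      (∀ u w, G.Reaches u w ↔ G'.Reaches u w) →
      ∀ (p : G.Polarization) (p' : G'.Polarization),
        correlations C G p O = correlations C G' p' O := fun G G' hG hG' h p p' =>
    (correlations_subset C O hG hG' h p p').antisymm
      (correlations_subset C O hG' hG (fun u w => (h u w).symm) p' p)
  refine ⟨key, fun G hG u v w huv hvw => ?_⟩
  have h := Digraph.addEdge_reaches_iff huv hvw
  have hG' : (G.addEdge u w).Acyclic := fun a ha => hG a ((h a a).1 ha)
  exact ⟨hG', key _ _ hG hG' fun a b => (h a b).symm⟩
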